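/- **Setting.** Let $\mathcal A$ be a unital $C^*$-algebra and let $H_{\mathcal A}=\ell^2(\mathcal A)$ be the standard (right) Hilbert $\mathcal A$-module, i.e. the set of sequences $(a_i)$ in $\mathcal A$ for which $\sum_i a_i^*a_i$ converges in norm, with inner product $\langle x,y\rangle=\sum_i x_i^*y_i$ and norm $\|x\|=\|\langle x,x\rangle\|^{1/2}$. Let $B^a(H_{\mathcal A})$ be the algebra of bounded adjointable operators on $H_{\mathcal A}$, with the operator norm. For $F\in B^a(H_{\mathcal A})$ consider pairs of decompositions $$H_{\mathcal A}=M_1\,\tilde\oplus\, N_1\ \xrightarrow{\ F\ }\ M_2\,\tilde\oplus\, N_2=H_{\mathcal A}\qquad(*)$$ into (topological, not necessarily orthogonal) direct sums of closed submodules such that $F(M_1)\subseteq M_2$, $F(N_1)\subseteq N_2$ and $F|_{M_1}:M_1\to M_2$ is an isomorphism. We write $F\in\mathcal M\Phi_+$ (resp. $F\in\mathcal M\Phi_-$) if there is such a pair with $N_1$ (resp. $N_2$) finitely generated over $\mathcal A$, and $F\in\mathcal M\Phi$ if there is such a pair with both $N_1$ and $N_2$ finitely generated; the latter is called an $\mathcal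 M\Phi$-decomposition of $F$. If $F\in\mathcal M\Phi$, its index is $\operatorname{index}F=[N_1]-[N_2]\in K(\mathcal A)$, computed from any $\mathcal M\Phi$-decomposition of $F$. Here $K(\mathcal A)=K_0(\mathcal A)$ is the Grothendieck group of the monoid of isomorphism classes of finitely generated projective right $\mathcal A$-modules under direct sum; finitely generated $N_1,N_2$ as in $(*)$ are projective. **Corollary 4.3.** Let $f:[0,1]\to B^a(H_{\mathcal A})$ be continuous and assume that $f([0,1])\subseteq\mathcal M\Phi_+\cup\mathcal M\Phi_-$. Then: 1. If $f(0)\in\mathcal M\Phi_+\setminus\mathcal M\Phi$, then $f(1)\in\mathcal M\Phi_+\setminus\mathcal M\Phi$. 2. If $f(0)\in\mathcal M\Phi_-\setminus\mathcal M\Phi$, then $f(1)\in\mathcal M\Phi_-\setminus\mathcal M\Phi$. 3. If $f(0)\in\mathcal M\Phi$, then $f(1)\in\mathcal M\Phi$ and $\operatorname{index}f(0)=\operatorname{index}f(1)$ in $K(\mathcal A)$, whichever $\mathcal M\Phi$-decompositions of $f(0)$ and $f(1)$ are used to compute the two indices. -/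

import Mathlib

universe u

/-! ## The standard Hilbert module `H_A = ℓ²(A)`

All modules are right modules over the unital C⋆-algebra `A`, that is, modules over `Aᵐᵒᵖ`;
the element `x · a` is written `MulOpposite.op a • x`. -/

section SquareSummable

variable {A : Type u} [CStarAlgebra A]

attribute [local instance] CStarAlgebra.spectralOrder CStarAlgebra.spectralOrderedRing

theorem summable_star_mul_self_of_le {x : ℕ → A} {b : ℕ → A} (hb : Summable b)
    (h : ∀ i, star (x i) * x i ≤ b i) : Summable fun i => star (x i) * x i := by
  rw [summable_iff_vanishing_norm] at hb ⊢
  intro ε hε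
  obtain ⟨s, hs⟩ := hb ε hε
  refine ⟨s, fun t ht => lt_of_le_of_lt ?_ (hs t ht)⟩
  exact CStarAlgebra.norm_le_norm_of_nonneg_of_le
    (Finset.sum_nonneg fun i _ => star_mul_self_nonneg (x i))
    (Finset.sum_le_sum fun i _ => h i)

theorem star_add_mul_add_le (a b : A) :
    star (a + b) * (a + b) ≤ 2 • (star a * a) + 2 • (star b * b) := by
  have h : 2 • (star a * a) + 2 • (star b * b) - star (a + b) * (a + b)
      = star (a - b) * (a - b) := by
    simp only [star_add, star_sub]
    noncomm_ring
  rw [← sub_nonneg, h]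
  exact star_mul_self_nonneg _

theorem summable_star_mul_self_add {x y : ℕ → A} (hx : Summable fun i => star (x i) * x i)
    (hy : Summable fun i => star (y i) * y i) :
    Summable fun i => star ((x + y) i) * (x + y) i :=
  summable_star_mul_self_of_le ((hx.const_smul 2).add (hy.const_smul 2))
    fun i => star_add_mul_add_le (x i) (y i)

theorem summable_star_mul {x y : ℕ → A} (hx : Summable fun i => star (x i) * x i)
    (hy : Summable fun i => star (y i) * y i) : Summable fun i => star (x i) * y i := by
  have hsc : ∀ (z : ℂ), Summable fun i => star ((z • y) i) * (z • y) i := fun z => by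
    have := (hy.const_smul (star z * z))
    refine this.congr fun i => ?_
    simp [smul_smul, mul_comm]
  have h1 := summable_star_mul_self_add hx hy
  have h2 := summable_star_mul_self_add hx (hsc Complex.I)
  have h3 := (h1.sub (hx.add hy)).sub ((h2.sub (hx.add hy)).const_smul Complex.I)
  have h4 := h3.const_smul (2⁻¹ : ℂ)
  refine h4.congr fun i => ?_
  simp only [Pi.add_apply, Pi.smul_apply, star_add, star_smul, add_mul, mul_add, smul_mul_assoc,
    mul_smul_comm, smul_add, smul_sub, smul_smul, Complex.star_def, Complex.conj_I]
  match_scalars <;> ring_nf <;> norm_num [Complex.I_sq]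

variable (A)

/-- The sequences `(aᵢ)` in `A` for which `∑ aᵢ⋆ aᵢ` converges in norm, as a right `A`-module.
(The summands are positive, so convergence of the partial sums and unconditional convergence
are the same.) -/
def squareSummable : Submodule Aᵐᵒᵖ (ℕ → A) where
  carrier := {x | Summable fun i => star (x i) * x i}
  add_mem' hx hy := summable_star_mul_self_add hx hy
  zero_mem' := by simp [summable_zero]
  smul_mem' a x hx := by
    have h := (Summable.mul_left (star a.unop) (Summable.mul_right a.unop hx))
    refine h.congr fun i => ?_
    simp [mul_assoc]

/-- The standard Hilbert module `H_A = ℓ²(A)` over `A`. -/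
def StdModule : Type u := ↥(squareSummable A)

end SquareSummable

namespace StdModule

variable {A : Type u} [CStarAlgebra A]

noncomputable instance : AddCommGroup (StdModule A) :=
  inferInstanceAs (AddCommGroup ↥(squareSummable A))
noncomputable instance : Module Aᵐᵒᵖ (StdModule A) :=
  inferInstanceAs (Module Aᵐᵒᵖ ↥(squareSummable A))
noncomputable instance : Module ℂ (StdModule A) :=
  inferInstanceAs (Module ℂ ↥(squareSummable A))
noncomputable instance : IsScalarTower ℂ Aᵐᵒᵖ (StdModule A) :=
  inferInstanceAs (IsScalarTower ℂ Aᵐᵒᵖ ↥(squareSummable A))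

instance : CoeFun (StdModule A) fun _ => ℕ → A := ⟨fun x => x.1⟩

/-- A square summable sequence as an element of `H_A`. -/
def mk (x : ℕ → A) (h : Summable fun i => star (x i) * x i) : StdModule A := ⟨x, h⟩

@[simp] theorem mk_apply (x : ℕ → A) (h) (i : ℕ) : (mk x h) i = x i := rfl

theorem summable (x : StdModule A) : Summable fun i => star (x i) * x i := x.2

@[ext] theorem ext {x y : StdModule A} (h : ∀ i, x i = y i) : x = y := Subtype.ext (funext h)

@[simp] theorem add_apply (x y : StdModule A) (i : ℕ) : (x + y) i = x i + y i := rfl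
@[simp] theorem sub_apply (x y : StdModule A) (i : ℕ) : (x - y) i = x i - y i := rfl
@[simp] theorem zero_apply (i : ℕ) : (0 : StdModule A) i = 0 := rfl
@[simp] theorem smul_apply (z : ℂ) (x : StdModule A) (i : ℕ) : (z • x) i = z • x i := rfl
@[simp] theorem op_smul_apply (a : Aᵐᵒᵖ) (x : StdModule A) (i : ℕ) :
    (a • x) i = x i * a.unop := rfl

/-- The `A`-valued inner product `⟨x, y⟩ = ∑ xᵢ⋆ yᵢ` of `H_A`. -/
noncomputable def innerA (x y : StdModule A) : A := ∑' i, star (x i) * y i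

theorem summable_inner (x y : StdModule A) : Summable fun i => star (x i) * y i :=
  summable_star_mul x.summable y.summable

theorem innerA_add_left (x y z : StdModule A) : innerA (x + y) z = innerA x z + innerA y z := by
  simp only [innerA, add_apply, star_add, add_mul]
  exact (summable_inner x z).tsum_add (summable_inner y z)

theorem innerA_add_right (x y z : StdModule A) : innerA x (y + z) = innerA x y + innerA x z := by
  simp only [innerA, add_apply, mul_add]
  exact (summable_inner x y).tsum_add (summable_inner x z)

theorem innerA_smul_left (c : ℂ) (x y : StdModule A) : innerA (c • x) y = star c • innerA x y := by
  simp only [innerA, smul_apply, star_smul, smul_mul_assoc]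
  exact (summable_inner x y).tsum_const_smul _

theorem innerA_smul_right (c : ℂ) (x y : StdModule A) : innerA x (c • y) = c • innerA x y := by
  simp only [innerA, smul_apply, mul_smul_comm]
  exact (summable_inner x y).tsum_const_smul _

/-- The norm `‖x‖ = ‖⟨x, x⟩‖ ^ (1 / 2)` of `H_A`. -/
noncomputable instance : Norm (StdModule A) := ⟨fun x => √‖innerA x x‖⟩

section order

attribute [local instance] CStarAlgebra.spectralOrder CStarAlgebra.spectralOrderedRing

/-- `H_A` is a Hilbert C⋆-module. -/
noncomputable abbrev cstarModule : CStarModule Aᵐᵒᵖ (StdModule A) where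
  inner x y := MulOpposite.op (innerA x y)
  inner_add_right {x y z} := by
    rw [← MulOpposite.op_add]
    exact congrArg MulOpposite.op (innerA_add_right x y z)
  inner_self_nonneg {x} := by
    rw [← MulOpposite.unop_le_unop]
    exact tsum_nonneg fun i => star_mul_self_nonneg (x i)
  inner_self {x} := by
    rw [MulOpposite.op_eq_zero_iff]
    constructor
    · intro h
      ext i
      have h1 := (hasSum_zero_iff_of_nonneg (fun i => star_mul_self_nonneg (x i))).1
        (show HasSum _ (0 : A) from h ▸ (show HasSum _ (innerA x x) from x.summable.hasSum))
      simpa using congrFun h1 i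
    · rintro rfl
      simp [innerA]
  inner_op_smul_right {a x y} := by
    apply MulOpposite.unop_injective
    simp only [innerA, op_smul_apply, ← mul_assoc, MulOpposite.unop_op, MulOpposite.unop_mul]
    exact (summable_inner x y).tsum_mul_right _
  inner_smul_right_complex {z x y} := by
    rw [← MulOpposite.op_smul]
    exact congrArg MulOpposite.op (innerA_smul_right z x y)
  star_inner x y := by
    apply MulOpposite.unop_injective
    simp only [innerA, MulOpposite.unop_op, MulOpposite.unop_star, tsum_star, star_mul, star_star]
  norm_eq_sqrt_norm_inner_self x := rfl

theorem normedSpaceCore : NormedSpace.Core ℂ (StdModule A) :=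
  letI := cstarModule (A := A)
  CStarModule.normedSpaceCore Aᵐᵒᵖ

end order

noncomputable instance : NormedAddCommGroup (StdModule A) := .ofCore normedSpaceCore
noncomputable instance : NormedSpace ℂ (StdModule A) := .ofCore normedSpaceCore

theorem norm_sq (x : StdModule A) : ‖x‖ ^ 2 = ‖innerA x x‖ :=
  Real.sq_sqrt (norm_nonneg _)

theorem norm_op_smul_le (a : A) (x : StdModule A) : ‖MulOpposite.op a • x‖ ≤ ‖x‖ * ‖a‖ := by
  refine (pow_le_pow_iff_left₀ (norm_nonneg _) (by positivity) two_ne_zero).1 ?_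
  have h : innerA (MulOpposite.op a • x) (MulOpposite.op a • x) = star a * innerA x x * a := by
    simp only [innerA, op_smul_apply, MulOpposite.unop_op, star_mul]
    rw [← x.summable.tsum_mul_left, ← (x.summable.mul_left (star a)).tsum_mul_right]
    simp only [mul_assoc]
  rw [norm_sq, h, mul_pow, norm_sq]
  calc ‖star a * innerA x x * a‖ ≤ ‖star a‖ * ‖innerA x x‖ * ‖a‖ := norm_mul₃_le
    _ = ‖innerA x x‖ * ‖a‖ ^ 2 := by rw [norm_star]; ring

section order

attribute [local instance] CStarAlgebra.spectralOrder CStarAlgebra.spectralOrderedRing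

theorem norm_sum_le (x : StdModule A) (t : Finset ℕ) :
    ‖∑ i ∈ t, star (x i) * x i‖ ≤ ‖x‖ ^ 2 := by
  rw [norm_sq]
  exact CStarAlgebra.norm_le_norm_of_nonneg_of_le
    (Finset.sum_nonneg fun i _ => star_mul_self_nonneg (x i))
    (x.summable.sum_le_tsum t fun i _ => star_mul_self_nonneg (x i))

theorem norm_apply_le (x : StdModule A) (i : ℕ) : ‖x i‖ ≤ ‖x‖ := by
  refine (pow_le_pow_iff_left₀ (norm_nonneg _) (norm_nonneg _) two_ne_zero).1 ?_
  have h := norm_sum_le x {i}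
  rwa [Finset.sum_singleton, CStarRing.norm_star_mul_self, ← sq] at h

theorem norm_le_of_sum_le {x : StdModule A} {r : ℝ} (hr : 0 ≤ r)
    (h : ∀ t : Finset ℕ, ‖∑ i ∈ t, star (x i) * x i‖ ≤ r ^ 2) : ‖x‖ ≤ r := by
  refine (pow_le_pow_iff_left₀ (norm_nonneg _) hr two_ne_zero).1 ?_
  rw [norm_sq]
  exact le_of_tendsto x.summable.hasSum.norm (Filter.Eventually.of_forall h)

instance : CompleteSpace (StdModule A) := by
  refine Metric.complete_of_cauchySeq_tendsto fun x hx => ?_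
  have hc : ∀ i, ∃ a, Filter.Tendsto (fun m => x m i) Filter.atTop (nhds a) := fun i => by
    refine cauchySeq_tendsto_of_complete (Metric.cauchySeq_iff'.2 fun ε hε => ?_)
    obtain ⟨N, hN⟩ := Metric.cauchySeq_iff'.1 hx ε hε
    refine ⟨N, fun n hn => lt_of_le_of_lt ?_ (hN n hn)⟩
    rw [dist_eq_norm, dist_eq_norm, ← sub_apply]
    exact norm_apply_le _ i
  choose y hy using hc
  have key : ∀ ε > 0, ∃ N, ∀ n ≥ N, ∀ t : Finset ℕ,
      ‖∑ i ∈ t, star (x n i - y i) * (x n i - y i)‖ ≤ ε ^ 2 := fun ε hε => by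
    obtain ⟨N, hN⟩ := Metric.cauchySeq_iff.1 hx ε hε
    refine ⟨N, fun n hn t => ?_⟩
    have hlim : Filter.Tendsto
        (fun m => ‖∑ i ∈ t, star (x n i - x m i) * (x n i - x m i)‖) Filter.atTop
        (nhds ‖∑ i ∈ t, star (x n i - y i) * (x n i - y i)‖) :=
      (tendsto_finsetSum _ fun i _ =>
        ((tendsto_const_nhds.sub (hy i)).star.mul (tendsto_const_nhds.sub (hy i)))).norm
    refine le_of_tendsto hlim (Filter.eventually_atTop.2 ⟨N, fun m hm => ?_⟩)
    have h1 := norm_sum_le (x n - x m) t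
    have h2 := hN n hn m hm
    rw [dist_eq_norm] at h2
    exact h1.trans (pow_le_pow_left₀ (norm_nonneg _) h2.le 2)
  have hsum : Summable fun i => star (y i) * y i := by
    rw [summable_iff_vanishing_norm]
    intro ε hε
    obtain ⟨N, hN⟩ := key √(ε / 8) (by positivity)
    obtain ⟨s, hs⟩ := summable_iff_vanishing_norm.1 (x N).summable (ε / 8) (by positivity)
    refine ⟨s, fun t ht => ?_⟩
    have hle : ∑ i ∈ t, star (y i) * y i ≤ 2 • ∑ i ∈ t, star (x N i) * x N i
        + 2 • ∑ i ∈ t, star (x N i - y i) * (x N i - y i) := by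
      rw [Finset.smul_sum, Finset.smul_sum, ← Finset.sum_add_distrib]
      refine Finset.sum_le_sum fun i _ => ?_
      have := star_add_mul_add_le (x N i) (-(x N i - y i))
      rwa [star_neg, neg_mul_neg, neg_sub, add_sub_cancel] at this
    have h1 := CStarAlgebra.norm_le_norm_of_nonneg_of_le
      (Finset.sum_nonneg fun i _ => star_mul_self_nonneg (y i)) hle
    have h2 := hN N le_rfl t
    rw [Real.sq_sqrt (by positivity)] at h2
    have h3 := hs t ht
    have h4 : ∀ a b : A, ‖2 • a + 2 • b‖ ≤ 2 * ‖a‖ + 2 * ‖b‖ := fun a b => by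
      rw [two_nsmul, two_nsmul, two_mul, two_mul]
      exact (norm_add_le _ _).trans (add_le_add (norm_add_le _ _) (norm_add_le _ _))
    linarith [h4 (∑ i ∈ t, star (x N i) * x N i)
      (∑ i ∈ t, star (x N i - y i) * (x N i - y i))]
  refine ⟨mk y hsum, Metric.tendsto_atTop.2 fun ε hε => ?_⟩
  obtain ⟨N, hN⟩ := key (ε / 2) (by positivity)
  refine ⟨N, fun n hn => ?_⟩
  rw [dist_eq_norm]
  have : ‖x n - mk y hsum‖ ≤ ε / 2 := norm_le_of_sum_le (by positivity) (hN n hn)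
  linarith

end order

/-- The coordinates `0, …, m - 1` of an element of `H_A`. -/
def coords (m : ℕ) : StdModule A →ₗ[Aᵐᵒᵖ] (Fin m → Aᵐᵒᵖ) where
  toFun x i := MulOpposite.op (x i)
  map_add' _ _ := rfl
  map_smul' _ _ := rfl

/-- The element of `H_A` with prescribed coordinates `0, …, m - 1`, the others being `0`. -/
def ofCoords (m : ℕ) : (Fin m → Aᵐᵒᵖ) →ₗ[Aᵐᵒᵖ] StdModule A where
  toFun c := mk (fun i => if h : i < m then (c ⟨i, h⟩).unop else 0) <| by
    refine summable_of_ne_finset_zero (s := Finset.range m) fun i hi => ?_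
    simp only [dif_neg (show ¬ i < m by simpa using hi), mul_zero]
  map_add' c d := by
    ext i
    by_cases h : i < m <;> simp [h]
  map_smul' a c := by
    ext i
    by_cases h : i < m <;> simp [h]

theorem ofCoords_apply (m : ℕ) (c : Fin m → Aᵐᵒᵖ) (i : ℕ) :
    (ofCoords m c) i = if h : i < m then (c ⟨i, h⟩).unop else 0 := rfl

theorem coords_apply (m : ℕ) (x : StdModule A) (i : Fin m) :
    coords m x i = MulOpposite.op (x i) := rfl

theorem tendsto_ofCoords_coords (x : StdModule A) :
    Filter.Tendsto (fun m => ofCoords m (coords m x)) Filter.atTop (nhds x) := by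
  rw [tendsto_iff_norm_sub_tendsto_zero]
  have h : ∀ m, ‖ofCoords m (coords m x) - x‖ = √‖∑' i, star (x (i + m)) * x (i + m)‖ := fun m => by
    have e : ∀ i, (ofCoords m (coords m x) - x) i = if i < m then 0 else - x i := fun i => by
      by_cases h : i < m <;> simp [h, ofCoords_apply, coords_apply]
    change √‖innerA _ _‖ = _
    rw [innerA, ← (ofCoords m (coords m x) - x).summable.sum_add_tsum_nat_add m]
    rw [Finset.sum_eq_zero fun i hi => by rw [e, if_pos (by simpa using hi), mul_zero], zero_add]
    simp only [e]
    simp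
  simp only [h]
  have := (tendsto_sum_nat_add fun i => star (x i) * x i).norm.sqrt
  simpa using this

end StdModule

/-! ## Finitely generated closed summands are projective -/

section Projective

variable {A : Type u} [CStarAlgebra A]

theorem isCompl_restrictScalars {M N : Submodule Aᵐᵒᵖ (StdModule A)} (h : IsCompl M N) :
    IsCompl (M.restrictScalars ℂ) (N.restrictScalars ℂ) := by
  refine ⟨Submodule.disjoint_def.2 fun x hM hN => Submodule.disjoint_def.1 h.disjoint x hM hN,
    codisjoint_iff.2 (eq_top_iff.2 fun x _ => ?_)⟩
  obtain ⟨a, ha, b, hb, rfl⟩ := Submodule.mem_sup.1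
    ((codisjoint_iff.1 h.codisjoint).symm ▸ Submodule.mem_top : x ∈ M ⊔ N)
  exact Submodule.add_mem_sup (show a ∈ M.restrictScalars ℂ from ha)
    (show b ∈ N.restrictScalars ℂ from hb)

theorem norm_map_pi_le {n : ℕ} {N : Submodule Aᵐᵒᵖ (StdModule A)}
    (u : (Fin n → Aᵐᵒᵖ) →ₗ[Aᵐᵒᵖ] N) (c : Fin n → Aᵐᵒᵖ) :
    ‖u c‖ ≤ (∑ j, ‖u (Pi.single j 1)‖) * ‖c‖ := by
  have hc : u c = ∑ j, c j • u (Pi.single j 1) := by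
    conv_lhs => rw [pi_eq_sum_univ' c]
    simp [map_sum, Pi.single]
  rw [hc, Finset.sum_mul]
  refine norm_sum_le_of_le _ fun j _ => ?_
  refine (StdModule.norm_op_smul_le (c j).unop (u (Pi.single j 1) : StdModule A)).trans ?_
  exact mul_le_mul_of_nonneg_left (norm_le_pi_norm c j) (norm_nonneg _)

/-- A finitely generated closed submodule of `H_A` which has a closed complement is projective. -/
theorem projective_of_isCompl {M N : Submodule Aᵐᵒᵖ (StdModule A)}
    (hM : IsClosed (M : Set (StdModule A))) (hN : IsClosed (N : Set (StdModule A)))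
    (h : IsCompl M N) (hfg : N.FG) : Module.Projective Aᵐᵒᵖ N := by
  let N' : Submodule ℂ (StdModule A) := N.restrictScalars ℂ
  have : CompleteSpace N' := hN.completeSpace_coe
  -- the projection onto `N` along `M`, which is continuous
  let p : StdModule A →ₗ[Aᵐᵒᵖ] N := Submodule.projectionOnto N M h.symm
  have hp : Continuous p :=
    (Submodule.projectionOntoL N' (M.restrictScalars ℂ)
      (Submodule.IsCompl.isTopCompl_of_isClosed (isCompl_restrictScalars h.symm) hN hM)).continuous
  have hpN : ∀ x : N, p x = x := fun x => Submodule.projectionOnto_apply_left h.symm x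
  -- the compression to `N` of the projection to the first `m` coordinates
  let q : ℕ → N →ₗ[Aᵐᵒᵖ] N := fun m => p ∘ₗ StdModule.ofCoords m ∘ₗ StdModule.coords m ∘ₗ N.subtype
  have hq : ∀ x : N, Filter.Tendsto (fun m => q m x) Filter.atTop (nhds x) := fun x => by
    have := (hp.tendsto (x : StdModule A)).comp (StdModule.tendsto_ofCoords_coords (x : StdModule A))
    rwa [hpN] at this
  -- a bounded surjection from a free module, with preimages of controlled norm
  have : Module.Finite Aᵐᵒᵖ N := Module.Finite.iff_fg.2 hfg
  obtain ⟨n, f, hf⟩ := Module.Finite.exists_fin' Aᵐᵒᵖ N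
  let f' : (Fin n → Aᵐᵒᵖ) →L[ℂ] N' :=
    LinearMap.mkContinuous (f.restrictScalars ℂ) _ (norm_map_pi_le f)
  obtain ⟨C, hC, hpre⟩ := f'.exists_preimage_norm_le hf
  -- for large `m` the compression is close to the identity, hence invertible
  have hlim : Filter.Tendsto
      (fun m => (∑ j, ‖(f - q m ∘ₗ f) (Pi.single j 1)‖) * C) Filter.atTop (nhds 0) := by
    rw [← zero_mul C]
    refine Filter.Tendsto.mul_const C ?_
    rw [← Finset.sum_const_zero (s := (Finset.univ : Finset (Fin n)))]
    refine tendsto_finsetSum _ fun j _ => ?_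
    have := (tendsto_const_nhds (x := f (Pi.single j 1))).sub (hq (f (Pi.single j 1)))
    simpa using this.norm
  obtain ⟨m, hm⟩ := (hlim.eventually_lt_const one_pos).exists
  have hbound : ∀ x : N, ‖x - q m x‖ ≤ (∑ j, ‖(f - q m ∘ₗ f) (Pi.single j 1)‖) * C * ‖x‖ := by
    intro x
    obtain ⟨c, rfl, hc⟩ := hpre x
    refine (norm_map_pi_le (f - q m ∘ₗ f) c).trans ?_
    rw [mul_assoc]
    exact mul_le_mul_of_nonneg_left hc (Finset.sum_nonneg fun _ _ => norm_nonneg _)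
  let L : N' →ₗ[ℂ] N' :=
    { toFun := fun x => (LinearMap.id - q m : N →ₗ[Aᵐᵒᵖ] N) x
      map_add' := fun x y => map_add (LinearMap.id - q m : N →ₗ[Aᵐᵒᵖ] N) x y
      map_smul' := fun z x => (LinearMap.id - q m : N →ₗ[Aᵐᵒᵖ] N).map_smul_of_tower z x }
  let T : N' →L[ℂ] N' := LinearMap.mkContinuous L _ hbound
  have hT : ‖T‖ < 1 := (LinearMap.mkContinuous_norm_le _
    (mul_nonneg (Finset.sum_nonneg fun _ _ => norm_nonneg _) hC.le) _).trans_lt hm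
  have hqT : ∀ x : N, (1 - T) x = q m x := fun x => sub_sub_cancel x (q m x)
  have hunit : IsUnit (1 - T) := (Units.oneSub T hT).isUnit
  have hbij : Function.Bijective (q m) := by
    have h1 : Function.Bijective (1 - T : N' →L[ℂ] N') :=
      (ContinuousLinearEquiv.ofUnit hunit.unit).bijective
    exact (funext hqT : ((1 - T : N' →L[ℂ] N') : N → N) = q m) ▸ h1
  let e := LinearEquiv.ofBijective (q m) hbij
  refine Module.Projective.of_split (StdModule.coords m ∘ₗ N.subtype)
    (e.symm.toLinearMap ∘ₗ p ∘ₗ StdModule.ofCoords m) (LinearMap.ext fun x => ?_)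
  exact e.symm_apply_apply x

end Projective

/-! ## Bounded adjointable operators -/

section Operators

variable (A : Type u) [CStarAlgebra A]

/-- `B^a(H_A)`: the algebra of bounded operators `T` on `H_A` which have an adjoint, that is, an
operator `S` with `⟨T x, y⟩ = ⟨x, S y⟩`. It carries the operator norm. -/
def AdjointableOperators : Subalgebra ℂ (StdModule A →L[ℂ] StdModule A) where
  carrier := {T | ∃ S : StdModule A →L[ℂ] StdModule A,
    ∀ x y, StdModule.innerA (T x) y = StdModule.innerA x (S y)}
  mul_mem' := by
    rintro T T' ⟨S, hS⟩ ⟨S', hS'⟩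
    exact ⟨S' * S, fun x y => by simp [hS, hS']⟩
  add_mem' := by
    rintro T T' ⟨S, hS⟩ ⟨S', hS'⟩
    refine ⟨S + S', fun x y => ?_⟩
    simp [StdModule.innerA_add_left, StdModule.innerA_add_right, hS, hS']
  algebraMap_mem' z := by
    refine ⟨algebraMap ℂ _ (star z), fun x y => ?_⟩
    simp [Algebra.algebraMap_eq_smul_one, StdModule.innerA_smul_left, StdModule.innerA_smul_right]

variable {A}

/-- Adjointable operators are `A`-linear. -/
theorem AdjointableOperators.map_op_smul (T : AdjointableOperators A) (a : Aᵐᵒᵖ)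
    (x : StdModule A) : T.1 (a • x) = a • T.1 x := by
  obtain ⟨S, hS⟩ := T.2
  have hl : ∀ u v : StdModule A,
      StdModule.innerA (a • u) v = star a.unop * StdModule.innerA u v := fun u v => by
    simp only [StdModule.innerA, StdModule.op_smul_apply, star_mul, mul_assoc]
    exact (StdModule.summable_inner u v).tsum_mul_left _
  have h0 : ∀ y, StdModule.innerA (T.1 (a • x) - a • T.1 x) y = 0 := fun y => by
    rw [sub_eq_add_neg, ← neg_one_smul ℂ (a • T.1 x), StdModule.innerA_add_left,
      StdModule.innerA_smul_left, hS, hl, hl, hS]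
    simp
  rw [← sub_eq_zero, ← norm_eq_zero, ← sq_eq_zero_iff, StdModule.norm_sq, h0, norm_zero]

end Operators

/-! ## The group `K(A)` -/

section KGroup

variable (R : Type u) [Ring R]

/-- A finitely generated projective module over `R`. -/
structure FGProjective where
  carrier : Type u
  [addCommGroup : AddCommGroup carrier]
  [module : Module R carrier]
  [finite : Module.Finite R carrier]
  [projective : Module.Projective R carrier]

attribute [instance] FGProjective.addCommGroup FGProjective.module FGProjective.finite
  FGProjective.projective

/-- Isomorphism of finitely generated projective modules. -/
instance FGProjective.setoid : Setoid (FGProjective R) where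
  r P Q := Nonempty (P.carrier ≃ₗ[R] Q.carrier)
  iseqv := ⟨fun _ => ⟨LinearEquiv.refl _ _⟩, fun ⟨e⟩ => ⟨e.symm⟩, fun ⟨e⟩ ⟨e'⟩ => ⟨e.trans e'⟩⟩

/-- The set of isomorphism classes of finitely generated projective `R`-modules. -/
def FGProjectiveClass : Type (u + 1) := Quotient (FGProjective.setoid R)

instance : Zero (FGProjectiveClass R) := ⟨Quotient.mk _ ⟨PUnit.{u + 1}⟩⟩

instance : Add (FGProjectiveClass R) :=
  ⟨Quotient.map₂ (fun P Q => ⟨P.carrier × Q.carrier⟩) fun _ _ ⟨e⟩ _ _ ⟨e'⟩ => ⟨e.prodCongr e'⟩⟩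

/-- Isomorphism classes of finitely generated projective modules form a commutative monoid under
the direct sum. -/
instance : AddCommMonoid (FGProjectiveClass R) where
  add_assoc := by
    rintro ⟨P⟩ ⟨Q⟩ ⟨S⟩
    exact Quotient.sound ⟨LinearEquiv.prodAssoc R _ _ _⟩
  zero_add := by
    rintro ⟨P⟩
    exact Quotient.sound ⟨LinearEquiv.uniqueProd⟩
  add_zero := by
    rintro ⟨P⟩
    exact Quotient.sound ⟨LinearEquiv.prodUnique⟩
  add_comm := by
    rintro ⟨P⟩ ⟨Q⟩
    exact Quotient.sound ⟨LinearEquiv.prodComm R _ _⟩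
  nsmul := nsmulRec

end KGroup

section Index

variable (A : Type u) [CStarAlgebra A]

/-- `K(A) = K₀(A)`: the Grothendieck group of the monoid of isomorphism classes of finitely
generated projective right `A`-modules. -/
abbrev KGroup : Type (u + 1) := Algebra.GrothendieckAddGroup (FGProjectiveClass Aᵐᵒᵖ)

/-- The class in `K(A)` of a finitely generated projective right `A`-module. -/
noncomputable def KGroup.cls (P : Type u) [AddCommGroup P] [Module Aᵐᵒᵖ P]
    [Module.Finite Aᵐᵒᵖ P] [Module.Projective Aᵐᵒᵖ P] : KGroup A :=
  Algebra.GrothendieckAddGroup.of (Quotient.mk _ ⟨P⟩ : FGProjectiveClass Aᵐᵒᵖ)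

variable {A}

/-! ## Semi-Fredholm operators -/

/-- `H_A = M₁ ⊕̃ N₁ ⟶ M₂ ⊕̃ N₂ = H_A` are decompositions into (topological, not necessarily
orthogonal) direct sums of closed submodules with respect to which `F` has a diagonal matrix
`diag(F₁, F₄)` such that `F₁ : M₁ → M₂` is an isomorphism.

An adjointable operator is bounded and `A`-linear, and the submodules are Banach spaces, so `F₁` is
an isomorphism as soon as it is bijective. -/
structure Diagonalizes (F : AdjointableOperators A) (M₁ N₁ M₂ N₂ : Submodule Aᵐᵒᵖ (StdModule A)) :
    Prop where
  isClosed_M₁ : IsClosed (M₁ : Set (StdModule A))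
  isClosed_N₁ : IsClosed (N₁ : Set (StdModule A))
  isClosed_M₂ : IsClosed (M₂ : Set (StdModule A))
  isClosed_N₂ : IsClosed (N₂ : Set (StdModule A))
  isCompl₁ : IsCompl M₁ N₁
  isCompl₂ : IsCompl M₂ N₂
  bijOn : Set.BijOn F.1 M₁ M₂
  mapsTo : Set.MapsTo F.1 N₁ N₂

variable (A)

/-- `MΦ₊(H_A)`: the upper semi-`A`-Fredholm operators. -/
def MPhiPlus : Set (AdjointableOperators A) :=
  {F | ∃ M₁ N₁ M₂ N₂, Diagonalizes F M₁ N₁ M₂ N₂ ∧ N₁.FG}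

/-- `MΦ₋(H_A)`: the lower semi-`A`-Fredholm operators. -/
def MPhiMinus : Set (AdjointableOperators A) :=
  {F | ∃ M₁ N₁ M₂ N₂, Diagonalizes F M₁ N₁ M₂ N₂ ∧ N₂.FG}

/-- `MΦ(H_A)`: the `A`-Fredholm operators. -/
def MPhi : Set (AdjointableOperators A) :=
  {F | ∃ M₁ N₁ M₂ N₂, Diagonalizes F M₁ N₁ M₂ N₂ ∧ N₁.FG ∧ N₂.FG}

variable {A}

/-- An `MΦ`-decomposition for `F`. -/
structure MPhiDecomposition (F : AdjointableOperators A) where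
  (M₁ N₁ M₂ N₂ : Submodule Aᵐᵒᵖ (StdModule A))
  diagonalizes : Diagonalizes F M₁ N₁ M₂ N₂
  fg₁ : N₁.FG
  fg₂ : N₂.FG

theorem mem_MPhi_iff {F : AdjointableOperators A} : F ∈ MPhi A ↔ Nonempty (MPhiDecomposition F) :=
  ⟨fun ⟨M₁, N₁, M₂, N₂, h, h₁, h₂⟩ => ⟨⟨M₁, N₁, M₂, N₂, h, h₁, h₂⟩⟩,
    fun ⟨⟨M₁, N₁, M₂, N₂, h, h₁, h₂⟩⟩ => ⟨M₁, N₁, M₂, N₂, h, h₁, h₂⟩⟩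

/-- The index `[N₁] - [N₂] ∈ K(A)` computed from an `MΦ`-decomposition. -/
noncomputable def MPhiDecomposition.index {F : AdjointableOperators A} (d : MPhiDecomposition F) :
    KGroup A :=
  have : Module.Finite Aᵐᵒᵖ d.N₁ := Module.Finite.iff_fg.2 d.fg₁
  have : Module.Finite Aᵐᵒᵖ d.N₂ := Module.Finite.iff_fg.2 d.fg₂
  have : Module.Projective Aᵐᵒᵖ d.N₁ := projective_of_isCompl d.diagonalizes.isClosed_M₁
    d.diagonalizes.isClosed_N₁ d.diagonalizes.isCompl₁ d.fg₁
  have : Module.Projective Aᵐᵒᵖ d.N₂ := projective_of_isCompl d.diagonalizes.isClosed_M₂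
    d.diagonalizes.isClosed_N₂ d.diagonalizes.isCompl₂ d.fg₂
  KGroup.cls A d.N₁ - KGroup.cls A d.N₂

end Index

/-!
An operator which is block diagonal with invertible corner `M₁ → M₂` retracts, as a two-term
complex, onto its other corner `N₁ → N₂`. Two such corners `N₁ → N₂` and `N₁' → N₂'` of the same
operator are therefore homotopy equivalent, which gives `N₂ × N₁' ≃ N₁ × N₂'`. Hence a single
decomposition of `F` in which `N₁` or `N₂` is finitely generated decides which of the classes `MΦ₊`
and `MΦ₋` contain `F`, and the index of `F` does not depend on the decomposition. For `G` near `F`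
the restriction to `M₁` is still injective with range complementary to `N₂`, so `G` has a
decomposition with the same `M₁` and `N₂`, and its `N₁`, being another complement of `M₁`, does not
change up to isomorphism. Both the classes and the index are thus locally constant.
-/

section LinearAlgebra

variable {R E E' : Type*} [Ring R] [AddCommGroup E] [Module R E] [AddCommGroup E'] [Module R E']

theorem bijective_coprod_subtype_iff {f : E →ₗ[R] E'} {N : Submodule R E'} :
    Function.Bijective (f.coprod N.subtype) ↔
      Function.Injective f ∧ IsCompl (LinearMap.range f) N := by
  have hrange : LinearMap.range (f.coprod N.subtype) = LinearMap.range f ⊔ N := by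
    rw [LinearMap.range_coprod, Submodule.range_subtype]
  constructor
  · rintro ⟨hinj, hsurj⟩
    refine ⟨fun x y hxy => ?_, Submodule.disjoint_def.2 ?_, codisjoint_iff.2 ?_⟩
    · have : (x, (0 : N)) = (y, 0) := hinj (by simp [hxy])
      exact congrArg Prod.fst this
    · rintro _ ⟨x, rfl⟩ hx
      have : (x, (0 : N)) = (0, ⟨f x, hx⟩) := hinj (by simp)
      exact (congrArg (fun p => (p.2 : E')) this).symm
    · rw [← hrange, LinearMap.range_eq_top.2 hsurj]
  · rintro ⟨hinj, hcompl⟩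
    refine ⟨LinearMap.ker_eq_bot.1 ?_, LinearMap.range_eq_top.1 (hrange.trans hcompl.sup_eq_top)⟩
    rw [LinearMap.ker_coprod_of_disjoint_range _ _ (by simpa using hcompl.disjoint),
      LinearMap.ker_eq_bot.2 hinj, Submodule.ker_subtype, Submodule.prod_bot]

theorem isCompl_comap_of_isCompl_map {f : E →ₗ[R] E'} {M : Submodule R E} {N : Submodule R E'}
    (hinj : Set.InjOn f M) (hcompl : IsCompl (M.map f) N) : IsCompl M (N.comap f) := by
  refine ⟨Submodule.disjoint_def.2 fun x hxM hxN => ?_,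
    codisjoint_iff.2 (Submodule.eq_top_iff'.2 fun x => ?_)⟩
  · refine hinj hxM M.zero_mem ?_
    rw [map_zero]
    exact Submodule.disjoint_def.1 hcompl.disjoint _ (Submodule.mem_map_of_mem hxM) hxN
  · obtain ⟨_, ⟨m, hm, rfl⟩, n, hn, hmn⟩ :=
      Submodule.mem_sup.1 (hcompl.sup_eq_top ▸ Submodule.mem_top : f x ∈ M.map f ⊔ N)
    have hxm : f (x - m) = n := by rw [map_sub, ← hmn, add_sub_cancel_left]
    exact Submodule.mem_sup.2 ⟨m, hm, x - m, by rwa [Submodule.mem_comap, hxm], add_sub_cancel m x⟩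

/-- Any two complements of a submodule are isomorphic, both being isomorphic to the quotient. -/
noncomputable def complementEquiv {M N N' : Submodule R E} (h : IsCompl M N) (h' : IsCompl M N') :
    N ≃ₗ[R] N' :=
  (Submodule.quotientEquivOfIsCompl M N h).symm.trans (Submodule.quotientEquivOfIsCompl M N' h')

theorem fg_iff_fg_of_isCompl {M N N' : Submodule R E} (h : IsCompl M N) (h' : IsCompl M N') :
    N.FG ↔ N'.FG :=
  ⟨fun hN => (hN.cofg_of_isCompl h.symm).fg_of_isCompl h',
    fun hN' => (hN'.cofg_of_isCompl h'.symm).fg_of_isCompl h⟩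

theorem moduleFinite_prod_iff :
    Module.Finite R (E × E') ↔ Module.Finite R E ∧ Module.Finite R E' :=
  ⟨fun _ => ⟨.of_surjective (LinearMap.fst R E E') LinearMap.fst_surjective,
    .of_surjective (LinearMap.snd R E E') LinearMap.snd_surjective⟩, fun ⟨_, _⟩ => inferInstance⟩

variable {F : E →ₗ[R] E'} {M₁ : Submodule R E} {M₂ N₂ : Submodule R E'}

/-- The inverse of the corner `M₁ → M₂` of `F`, extended by zero to a complement `N₂` of `M₂`. -/
noncomputable def cornerInverse (h₂ : IsCompl M₂ N₂) (hM : Set.BijOn F M₁ M₂) : E' →ₗ[R] E :=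
  M₁.subtype ∘ₗ (LinearEquiv.ofBijective (F.restrict fun _ hx => hM.mapsTo hx) hM.bijective).symm ∘ₗ
    Submodule.projectionOnto M₂ N₂ h₂

theorem cornerInverse_map (h₂ : IsCompl M₂ N₂) (hM : Set.BijOn F M₁ M₂) {m : E} (hm : m ∈ M₁) :
    cornerInverse h₂ hM (F m) = m := by
  let e := LinearEquiv.ofBijective (F.restrict fun _ hx => hM.mapsTo hx) hM.bijective
  have hproj : Submodule.projectionOnto M₂ N₂ h₂ (F m) = e ⟨m, hm⟩ :=
    Submodule.projectionOnto_apply_left h₂ (e ⟨m, hm⟩)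
  exact congrArg Subtype.val ((congrArg e.symm hproj).trans (e.symm_apply_apply ⟨m, hm⟩))

theorem cornerInverse_eq_zero (h₂ : IsCompl M₂ N₂) (hM : Set.BijOn F M₁ M₂) {n : E'}
    (hn : n ∈ N₂) : cornerInverse h₂ hM n = 0 := by
  simp only [cornerInverse, LinearMap.comp_apply,
    (Submodule.projectionOnto_apply_eq_zero_iff h₂).2 hn, map_zero]

end LinearAlgebra

section DeformationRetract

variable {R E E' N₁ N₂ N₁' N₂' : Type*} [Ring R] [AddCommGroup E] [Module R E]
  [AddCommGroup E'] [Module R E'] [AddCommGroup N₁] [Module R N₁] [AddCommGroup N₂] [Module R N₂]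
  [AddCommGroup N₁'] [Module R N₁'] [AddCommGroup N₂'] [Module R N₂']

/-- A strong deformation retraction of the two-term complex `F : E → E'` onto the two-term complex
`D : N₁ → N₂`: chain maps `i` and `p` with `p i = 1`, and a homotopy `G` from `i p` to the identity,
that is, a parametrix of `F`, normalized by the side conditions `p G = 0` and `G i = 0`. -/
structure StrongDeformationRetract (F : E →ₗ[R] E') (D : N₁ →ₗ[R] N₂) where
  i₁ : N₁ →ₗ[R] E
  i₂ : N₂ →ₗ[R] E'
  p₁ : E →ₗ[R] N₁
  p₂ : E' →ₗ[R] N₂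
  G : E' →ₗ[R] E
  i₂_map : ∀ x, i₂ (D x) = F (i₁ x)
  map_p₁ : ∀ x, D (p₁ x) = p₂ (F x)
  p₁_i₁ : ∀ x, p₁ (i₁ x) = x
  p₂_i₂ : ∀ y, p₂ (i₂ y) = y
  i₁_p₁ : ∀ x, i₁ (p₁ x) = x - G (F x)
  i₂_p₂ : ∀ y, i₂ (p₂ y) = y - F (G y)
  p₁_G : ∀ y, p₁ (G y) = 0
  G_i₂ : ∀ y, G (i₂ y) = 0

namespace StrongDeformationRetract

variable {F : E →ₗ[R] E'} {D : N₁ →ₗ[R] N₂} {D' : N₁' →ₗ[R] N₂'}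

attribute [simp] i₂_map map_p₁ p₁_i₁ p₂_i₂ i₁_p₁ i₂_p₂ p₁_G G_i₂

/-- Two retracts of the same two-term complex are stably isomorphic. The mapping cone of the
homotopy equivalence `p' i` between them is the contractible complex `N₁ → N₂ × N₁' → N₂'`; a
contraction splits it, and the two matrices below spell out the splitting. -/
def prodEquiv (r : StrongDeformationRetract F D) (r' : StrongDeformationRetract F D') :
    (N₂ × N₁') ≃ₗ[R] N₁ × N₂' :=
  LinearEquiv.ofLinearMap
    (((r.p₁ ∘ₗ r'.G ∘ₗ r.i₂).coprod (r.p₁ ∘ₗ r'.i₁)).prod ((r'.p₂ ∘ₗ r.i₂).coprod (-D')))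
    ((D.coprod (r.p₂ ∘ₗ r'.i₂)).prod ((r'.p₁ ∘ₗ r.i₁).coprod (-(r'.p₁ ∘ₗ r.G ∘ₗ r'.i₂))))
    (by ext x <;> simp)
    (by ext x <;> simp)

/-- The retraction of `F` onto its corner `N₁ → N₂`, when `F` is block diagonal with respect to
`E = M₁ ⊕ N₁` and `E' = M₂ ⊕ N₂` with an invertible corner `M₁ → M₂`. -/
noncomputable def ofIsCompl {M₁ N₁ : Submodule R E} {M₂ N₂ : Submodule R E'} (h₁ : IsCompl M₁ N₁)
    (h₂ : IsCompl M₂ N₂) (hM : Set.BijOn F M₁ M₂) (hN : ∀ x ∈ N₁, F x ∈ N₂) :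
    StrongDeformationRetract F (F.restrict hN) :=
  have exists_add (x : E) : ∃ m ∈ M₁, ∃ n : N₁, m + n = x := by
    obtain ⟨m, hm, n, hn, rfl⟩ := Submodule.mem_sup.1 (h₁.sup_eq_top ▸ Submodule.mem_top (x := x))
    exact ⟨m, hm, ⟨n, hn⟩, rfl⟩
  have exists_map_add (y : E') : ∃ m ∈ M₁, ∃ n : N₂, F m + n = y := by
    obtain ⟨_, hm', n, hn, rfl⟩ :=
      Submodule.mem_sup.1 (h₂.sup_eq_top ▸ Submodule.mem_top (x := y))
    obtain ⟨m, hm, rfl⟩ := hM.surjOn hm'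
    exact ⟨m, hm, ⟨n, hn⟩, rfl⟩
  have proj₁_left {m : E} (hm : m ∈ M₁) : Submodule.projectionOnto N₁ M₁ h₁.symm m = 0 :=
    (Submodule.projectionOnto_apply_eq_zero_iff h₁.symm).2 hm
  have proj₂_left {m : E} (hm : m ∈ M₁) : Submodule.projectionOnto N₂ M₂ h₂.symm (F m) = 0 :=
    (Submodule.projectionOnto_apply_eq_zero_iff h₂.symm).2 (hM.mapsTo hm)
  { i₁ := N₁.subtype
    i₂ := N₂.subtype
    p₁ := Submodule.projectionOnto N₁ M₁ h₁.symm
    p₂ := Submodule.projectionOnto N₂ M₂ h₂.symm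
    G := cornerInverse h₂ hM
    i₂_map := fun _ => rfl
    map_p₁ := fun x => by
      obtain ⟨m, hm, n, rfl⟩ := exists_add x
      have proj₂_right : Submodule.projectionOnto N₂ M₂ h₂.symm (F n) = F.restrict hN n :=
        Submodule.projectionOnto_apply_left h₂.symm (F.restrict hN n)
      simp [proj₁_left hm, proj₂_left hm, proj₂_right]
    p₁_i₁ := Submodule.projectionOnto_apply_left h₁.symm
    p₂_i₂ := Submodule.projectionOnto_apply_left h₂.symm
    i₁_p₁ := fun x => by
      obtain ⟨m, hm, n, rfl⟩ := exists_add x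
      simp [proj₁_left hm, cornerInverse_map h₂ hM hm, cornerInverse_eq_zero h₂ hM (hN n n.2)]
    i₂_p₂ := fun y => by
      obtain ⟨m, hm, n, rfl⟩ := exists_map_add y
      simp [proj₂_left hm, cornerInverse_map h₂ hM hm, cornerInverse_eq_zero h₂ hM n.2]
    p₁_G := fun _ => proj₁_left (Subtype.coe_prop _)
    G_i₂ := fun y => cornerInverse_eq_zero h₂ hM y.2 }

end StrongDeformationRetract

end DeformationRetract

section Banach

variable {𝕜 X Y : Type*} [NontriviallyNormedField 𝕜] [NormedAddCommGroup X] [NormedSpace 𝕜 X]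
  [CompleteSpace X] [NormedAddCommGroup Y] [NormedSpace 𝕜 Y] [CompleteSpace Y]

theorem isOpen_setOf_bijective : IsOpen {T : X →L[𝕜] Y | Function.Bijective T} := by
  convert ContinuousLinearEquiv.isOpen (𝕜 := 𝕜) (E := X) (F := Y) using 1
  refine Set.Subset.antisymm (fun T hT => ?_) ?_
  · exact ⟨.ofBijective T (LinearMap.ker_eq_bot.2 hT.1) (LinearMap.range_eq_top.2 hT.2),
      ContinuousLinearEquiv.coe_ofBijective _ _ _⟩
  · rintro _ ⟨e, rfl⟩
    exact e.bijective

theorem isOpen_setOf_injective_and_isCompl_range {N : Submodule 𝕜 Y} (hN : IsClosed (N : Set Y)) :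
    IsOpen {T : X →L[𝕜] Y | Function.Injective T ∧ IsCompl (LinearMap.range T.toLinearMap) N} := by
  have : CompleteSpace N := hN.completeSpace_coe
  have hcont : Continuous fun T : X →L[𝕜] Y => T.coprod N.subtypeL :=
    (ContinuousLinearMap.coprodEquivL 𝕜).continuous.comp (continuous_id.prodMk continuous_const)
  convert isOpen_setOf_bijective.preimage hcont using 1
  ext T
  exact bijective_coprod_subtype_iff.symm

end Banach

section Decompositions

variable {A : Type u} [CStarAlgebra A]

/-- An adjointable operator as an `A`-linear map. -/
noncomputable def AdjointableOperators.toLinearMap (F : AdjointableOperators A) :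
    StdModule A →ₗ[Aᵐᵒᵖ] StdModule A where
  toFun := F.1
  map_add' := map_add F.1
  map_smul' := AdjointableOperators.map_op_smul F

open AdjointableOperators

theorem AdjointableOperators.range_domRestrict (F : AdjointableOperators A)
    (M : Submodule Aᵐᵒᵖ (StdModule A)) :
    LinearMap.range (F.1.domRestrict (M.restrictScalars ℂ)).toLinearMap =
      (M.map (toLinearMap F)).restrictScalars ℂ :=
  LinearMap.range_domRestrict _ _

namespace Diagonalizes

variable {F G : AdjointableOperators A}
  {M₁ N₁ M₂ N₂ M₁' N₁' M₂' N₂' : Submodule Aᵐᵒᵖ (StdModule A)}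

theorem nonempty_prod_equiv (h : Diagonalizes F M₁ N₁ M₂ N₂) (h' : Diagonalizes F M₁' N₁' M₂' N₂') :
    Nonempty ((N₂ × N₁') ≃ₗ[Aᵐᵒᵖ] N₁ × N₂') :=
  ⟨(StrongDeformationRetract.ofIsCompl (F := toLinearMap F) h.isCompl₁ h.isCompl₂ h.bijOn
    fun _ hx => h.mapsTo hx).prodEquiv
      (.ofIsCompl h'.isCompl₁ h'.isCompl₂ h'.bijOn fun _ hx => h'.mapsTo hx)⟩

theorem fg_and_fg_iff (h : Diagonalizes F M₁ N₁ M₂ N₂) (h' : Diagonalizes F M₁' N₁' M₂' N₂') :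
    N₂.FG ∧ N₁'.FG ↔ N₁.FG ∧ N₂'.FG := by
  obtain ⟨e⟩ := h.nonempty_prod_equiv h'
  simp only [← Module.Finite.iff_fg, ← moduleFinite_prod_iff, Module.Finite.equiv_iff e]

theorem of_injOn_of_isCompl_map
    (hM₁ : IsClosed (M₁ : Set (StdModule A))) (hN₂ : IsClosed (N₂ : Set (StdModule A)))
    (hinj : Set.InjOn G.1 M₁) (hcompl : IsCompl (M₁.map (toLinearMap G)) N₂) :
    Diagonalizes G M₁ (N₂.comap (toLinearMap G)) (M₁.map (toLinearMap G)) N₂ where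
  isClosed_M₁ := hM₁
  isClosed_N₁ := hN₂.preimage G.1.continuous
  isClosed_M₂ := by
    have : CompleteSpace (M₁.restrictScalars ℂ) := hM₁.completeSpace_coe
    have hrange := range_domRestrict G M₁
    have hcompl' := (Submodule.isCompl_restrictScalars_iff ℂ).2 hcompl
    rw [← hrange] at hcompl'
    have hclosed := ContinuousLinearMap.closed_complemented_range_of_isCompl_of_ker_eq_bot
      (G.1.domRestrict (M₁.restrictScalars ℂ)) _ hcompl' hN₂
      (LinearMap.ker_eq_bot.2 (Set.injOn_iff_injective.1 hinj))
    rwa [hrange] at hclosed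
  isClosed_N₂ := hN₂
  isCompl₁ := isCompl_comap_of_isCompl_map hinj hcompl
  isCompl₂ := hcompl
  bijOn := hinj.bijOn_image
  mapsTo := fun _ hx => hx

theorem eventually_exists (h : Diagonalizes F M₁ N₁ M₂ N₂) :
    ∀ᶠ G in nhds F, ∃ N₁' M₂', Diagonalizes G M₁ N₁' M₂' N₂ := by
  have : CompleteSpace (M₁.restrictScalars ℂ) := h.isClosed_M₁.completeSpace_coe
  let U : Set (M₁.restrictScalars ℂ →L[ℂ] StdModule A) :=
    {T | Function.Injective T ∧ IsCompl (LinearMap.range T.toLinearMap) (N₂.restrictScalars ℂ)}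
  have mem_U_iff (G : AdjointableOperators A) : G.1.domRestrict (M₁.restrictScalars ℂ) ∈ U ↔
      Set.InjOn G.1 M₁ ∧ IsCompl (M₁.map (toLinearMap G)) N₂ := by
    rw [Set.injOn_iff_injective, ← Submodule.isCompl_restrictScalars_iff ℂ, ← range_domRestrict G]
    rfl
  have hU : IsOpen U := isOpen_setOf_injective_and_isCompl_range h.isClosed_N₂
  have hcont : Continuous fun G : AdjointableOperators A =>
      G.1.domRestrict (M₁.restrictScalars ℂ) := continuous_subtype_val.clm_comp continuous_const
  have hmap : M₁.map (toLinearMap F) = M₂ := SetLike.coe_injective h.bijOn.image_eq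
  have hF : F.1.domRestrict (M₁.restrictScalars ℂ) ∈ U :=
    (mem_U_iff F).2 ⟨h.bijOn.injOn, hmap ▸ h.isCompl₂⟩
  filter_upwards [hcont.continuousAt.eventually_mem (hU.mem_nhds hF)] with G hG
  obtain ⟨hinj, hcompl⟩ := (mem_U_iff G).1 hG
  exact ⟨_, _, of_injOn_of_isCompl_map h.isClosed_M₁ h.isClosed_N₂ hinj hcompl⟩

theorem mem_MPhiPlus_iff (h : Diagonalizes F M₁ N₁ M₂ N₂) (hfg : N₁.FG ∨ N₂.FG) :
    F ∈ MPhiPlus A ↔ N₁.FG := by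
  refine ⟨fun ⟨_, _, _, _, h', hfg'⟩ => ?_, fun hN₁ => ⟨_, _, _, _, h, hN₁⟩⟩
  exact hfg.elim id fun hN₂ => ((h.fg_and_fg_iff h').1 ⟨hN₂, hfg'⟩).1

theorem mem_MPhiMinus_iff (h : Diagonalizes F M₁ N₁ M₂ N₂) (hfg : N₁.FG ∨ N₂.FG) :
    F ∈ MPhiMinus A ↔ N₂.FG := by
  refine ⟨fun ⟨_, _, _, _, h', hfg'⟩ => ?_, fun hN₂ => ⟨_, _, _, _, h, hN₂⟩⟩
  exact hfg.elim (fun hN₁ => ((h.fg_and_fg_iff h').2 ⟨hN₁, hfg'⟩).1) id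

end Diagonalizes

section Classes

variable {F : AdjointableOperators A}

theorem exists_diagonalizes_fg_or_fg (hF : F ∈ MPhiPlus A ∪ MPhiMinus A) :
    ∃ M₁ N₁ M₂ N₂, Diagonalizes F M₁ N₁ M₂ N₂ ∧ (N₁.FG ∨ N₂.FG) := by
  rcases hF with ⟨M₁, N₁, M₂, N₂, h, hfg⟩ | ⟨M₁, N₁, M₂, N₂, h, hfg⟩
  exacts [⟨_, _, _, _, h, .inl hfg⟩, ⟨_, _, _, _, h, .inr hfg⟩]

theorem MPhi_eq_inter : MPhi A = MPhiPlus A ∩ MPhiMinus A := by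
  refine Set.Subset.antisymm (fun F ⟨_, _, _, _, h, h₁, h₂⟩ => ⟨⟨_, _, _, _, h, h₁⟩, ?_⟩) ?_
  · exact ⟨_, _, _, _, h, h₂⟩
  · rintro F ⟨⟨_, _, _, _, h, hfg⟩, hminus⟩
    exact ⟨_, _, _, _, h, hfg, (h.mem_MPhiMinus_iff (.inl hfg)).1 hminus⟩

theorem eventually_mem_MPhiPlus_iff_and_mem_MPhiMinus_iff (hF : F ∈ MPhiPlus A ∪ MPhiMinus A) :
    ∀ᶠ G in nhds F, (G ∈ MPhiPlus A ↔ F ∈ MPhiPlus A) ∧ (G ∈ MPhiMinus A ↔ F ∈ MPhiMinus A) := by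
  obtain ⟨M₁, N₁, M₂, N₂, h, hfg⟩ := exists_diagonalizes_fg_or_fg hF
  filter_upwards [h.eventually_exists] with G ⟨N₁', M₂', h'⟩
  have hN₁ : N₁'.FG ↔ N₁.FG := fg_iff_fg_of_isCompl h'.isCompl₁ h.isCompl₁
  have hfg' : N₁'.FG ∨ N₂.FG := hfg.imp_left hN₁.2
  exact ⟨by rw [h'.mem_MPhiPlus_iff hfg', h.mem_MPhiPlus_iff hfg, hN₁],
    by rw [h'.mem_MPhiMinus_iff hfg', h.mem_MPhiMinus_iff hfg]⟩

theorem mem_MPhiPlus_iff_and_mem_MPhiMinus_iff_of_continuous {X : Type*} [TopologicalSpace X]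
    [PreconnectedSpace X] {f : X → AdjointableOperators A} (hf : Continuous f)
    (hsemi : ∀ t, f t ∈ MPhiPlus A ∪ MPhiMinus A) (s t : X) :
    (f s ∈ MPhiPlus A ↔ f t ∈ MPhiPlus A) ∧ (f s ∈ MPhiMinus A ↔ f t ∈ MPhiMinus A) := by
  have hconst : IsLocallyConstant fun t => (f t ∈ MPhiPlus A, f t ∈ MPhiMinus A) := by
    refine (IsLocallyConstant.iff_eventually_eq _).2 fun t => ?_
    filter_upwards [hf.continuousAt.eventually
      (eventually_mem_MPhiPlus_iff_and_mem_MPhiMinus_iff (hsemi t))] with s hs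
    exact Prod.ext (propext hs.1) (propext hs.2)
  simpa only [Prod.mk.injEq, eq_iff_iff] using hconst.apply_eq_of_preconnectedSpace s t

end Classes

end Decompositions

section Index

variable {A : Type u} [CStarAlgebra A]

namespace KGroup

variable (P Q : Type u) [AddCommGroup P] [Module Aᵐᵒᵖ P] [Module.Finite Aᵐᵒᵖ P]
  [Module.Projective Aᵐᵒᵖ P] [AddCommGroup Q] [Module Aᵐᵒᵖ Q] [Module.Finite Aᵐᵒᵖ Q]
  [Module.Projective Aᵐᵒᵖ Q]

variable {P Q} in
theorem cls_congr (e : P ≃ₗ[Aᵐᵒᵖ] Q) : cls A P = cls A Q :=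
  congrArg Algebra.GrothendieckAddGroup.of (Quotient.sound ⟨e⟩)

theorem cls_prod : cls A (P × Q) = cls A P + cls A Q :=
  let p : FGProjectiveClass Aᵐᵒᵖ := Quotient.mk _ ⟨P⟩
  let q : FGProjectiveClass Aᵐᵒᵖ := Quotient.mk _ ⟨Q⟩
  map_add Algebra.GrothendieckAddGroup.of p q

end KGroup

namespace MPhiDecomposition

variable {F G : AdjointableOperators A}

instance (d : MPhiDecomposition F) : Module.Finite Aᵐᵒᵖ d.N₁ := Module.Finite.iff_fg.2 d.fg₁

instance (d : MPhiDecomposition F) : Module.Finite Aᵐᵒᵖ d.N₂ := Module.Finite.iff_fg.2 d.fg₂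

instance (d : MPhiDecomposition F) : Module.Projective Aᵐᵒᵖ d.N₁ :=
  projective_of_isCompl d.diagonalizes.isClosed_M₁ d.diagonalizes.isClosed_N₁
    d.diagonalizes.isCompl₁ d.fg₁

instance (d : MPhiDecomposition F) : Module.Projective Aᵐᵒᵖ d.N₂ :=
  projective_of_isCompl d.diagonalizes.isClosed_M₂ d.diagonalizes.isClosed_N₂
    d.diagonalizes.isCompl₂ d.fg₂

theorem index_def (d : MPhiDecomposition F) :
    d.index = KGroup.cls A d.N₁ - KGroup.cls A d.N₂ := rfl

theorem index_eq (d d' : MPhiDecomposition F) : d.index = d'.index := by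
  obtain ⟨e⟩ := d.diagonalizes.nonempty_prod_equiv d'.diagonalizes
  have hcls : KGroup.cls A d.N₂ + KGroup.cls A d'.N₁ = KGroup.cls A d.N₁ + KGroup.cls A d'.N₂ := by
    rw [← KGroup.cls_prod, ← KGroup.cls_prod, KGroup.cls_congr e]
  rw [index_def, index_def, sub_eq_sub_iff_add_eq_add, ← hcls, add_comm]

theorem index_eq_of_equiv (d : MPhiDecomposition F) (d' : MPhiDecomposition G)
    (e₁ : d.N₁ ≃ₗ[Aᵐᵒᵖ] d'.N₁) (e₂ : d.N₂ ≃ₗ[Aᵐᵒᵖ] d'.N₂) : d.index = d'.index := by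
  rw [index_def, index_def, KGroup.cls_congr e₁, KGroup.cls_congr e₂]

theorem eventually_index_eq (d : MPhiDecomposition F) :
    ∀ᶠ G in nhds F, ∀ d' : MPhiDecomposition G, d'.index = d.index := by
  filter_upwards [d.diagonalizes.eventually_exists] with G ⟨N₁', M₂', h⟩ d'
  let d₀ : MPhiDecomposition G :=
    ⟨d.M₁, N₁', M₂', d.N₂, h,
      (fg_iff_fg_of_isCompl d.diagonalizes.isCompl₁ h.isCompl₁).1 d.fg₁, d.fg₂⟩
  calc d'.index = d₀.index := d'.index_eq d₀
    _ = d.index := d₀.index_eq_of_equiv d (complementEquiv h.isCompl₁ d.diagonalizes.isCompl₁)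
      (LinearEquiv.refl _ _)

theorem index_eq_of_continuous {X : Type*} [TopologicalSpace X] [PreconnectedSpace X]
    {f : X → AdjointableOperators A} (hf : Continuous f) (d : ∀ t, MPhiDecomposition (f t))
    (s t : X) : (d s).index = (d t).index := by
  have hconst : IsLocallyConstant fun t => (d t).index :=
    (IsLocallyConstant.iff_eventually_eq _).2 fun t =>
      (hf.continuousAt.eventually (d t).eventually_index_eq).mono fun s hs => hs (d s)
  exact hconst.apply_eq_of_preconnectedSpace s t

end MPhiDecomposition

end Index

theorem corollary4p3_general {A : Type u} [CStarAlgebra A] {X : Type*} [TopologicalSpace X]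
    [PreconnectedSpace X] (f : X → AdjointableOperators A) (hf : Continuous f)
    (hsemi : ∀ t, f t ∈ MPhiPlus A ∪ MPhiMinus A) (s t : X) :
    (f s ∈ MPhiPlus A \ MPhi A → f t ∈ MPhiPlus A \ MPhi A) ∧
    (f s ∈ MPhiMinus A \ MPhi A → f t ∈ MPhiMinus A \ MPhi A) ∧
    (f s ∈ MPhi A → f t ∈ MPhi A ∧
      ∀ (d₀ : MPhiDecomposition (f s)) (d₁ : MPhiDecomposition (f t)), d₀.index = d₁.index) := by
  have htype := mem_MPhiPlus_iff_and_mem_MPhiMinus_iff_of_continuous hf hsemi s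
  have hfred (x : X) : f s ∈ MPhi A ↔ f x ∈ MPhi A := by
    simp only [MPhi_eq_inter, Set.mem_inter_iff, (htype x).1, (htype x).2]
  refine ⟨(and_congr (htype t).1 (not_congr (hfred t))).1,
    (and_congr (htype t).2 (not_congr (hfred t))).1, fun hs => ⟨(hfred t).1 hs, fun d₀ d₁ => ?_⟩⟩
  have d (x : X) : MPhiDecomposition (f x) := (mem_MPhi_iff.1 ((hfred x).1 hs)).some
  calc d₀.index = (d s).index := d₀.index_eq (d s)
    _ = (d t).index := MPhiDecomposition.index_eq_of_continuous hf d s t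
    _ = d₁.index := (d t).index_eq d₁

theorem corollary4p3 {A : Type u} [CStarAlgebra A] (f : unitInterval → AdjointableOperators A)
    (hf : Continuous f) (hsemi : ∀ t, f t ∈ MPhiPlus A ∪ MPhiMinus A) :
    (f 0 ∈ MPhiPlus A \ MPhi A → f 1 ∈ MPhiPlus A \ MPhi A) ∧
    (f 0 ∈ MPhiMinus A \ MPhi A → f 1 ∈ MPhiMinus A \ MPhi A) ∧
    (f 0 ∈ MPhi A → f 1 ∈ MPhi A ∧
      ∀ (d₀ : MPhiDecomposition (f 0)) (d₁ : MPhiDecomposition (f 1)), d₀.index = d₁.index) :=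
  corollary4p3_general f hf hsemi 0 1
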